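/- **Setting.** Let $\Omega\subset\mathbb{R}^n$ be open, $C\subset\Omega$ nonempty, convex and compact, and $F:\Omega\to\mathbb{R}^n$ analytic. Let $x_*\in C$ satisfy $F(x_*)=0$ with $F'(x_*)$ nonsingular. Norms are Euclidean, with the induced operator norms for linear and multilinear maps; $B(p,t)$ is the open ball, and $\mathrm{cond}(A)=\|A^{-1}\|\,\|A\|$. **CondG procedure.** For $x\in C$, $y\in\mathbb{R}^n$ and $\varepsilon\ge 0$, $\mathrm{CondG}(y,x,\varepsilon)$ is computed as follows. Put $z_1=x$. For $t=1,2,\dots$ let $u_t$ be a minimizer of $u\mapsto\langle z_t-y,u-z_t\rangle$ over $C$, with minimal value $g_t^*$. If $g_t^*\ge-\varepsilon$, stop and return $z_t$; otherwise put $z_{t+1}=z_t+\alpha_t(u_t-z_t)$ with $\alpha_t=\min\{1,-g_t^*/\|u_t-z_t\|^2\}$. **INL-CondG method.** Given $x_0\in C$ and $\{\theta_k\}\subset[0,\infty)$, for $k=0,1,\dots$: if $F(x_k)=0$, stop; otherwise choose an invertible linear operator $M_k$ and vectors $s_k,r_k,y_k$ with $M_ks_k=-F(x_k)+r_k$ and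 $y_k=x_k+s_k$, and let $x_{k+1}=\mathrm{CondG}(y_k,x_k,\theta_k\|s_k\|^2)$. **Statement.** Assume $$\gamma:=\sup_{m>1}\left\|\frac{F'(x_*)^{-1}F^{(m)}(x_*)}{m!}\right\|^{1/(m-1)}<+\infty ,$$ and let $\kappa:=\sup\{t\in[0,1/\gamma): B(x_*,t)\subset\Omega\}$. Take $0\le\vartheta<1$ and $0\le\omega_2<\omega_1$ with $\omega_1\vartheta+\omega_2<1$, and $\lambda\in\big[0,(1-\omega_2-\omega_1\vartheta)/(\omega_1(1+\vartheta))\big)$. Put $$a:=\omega_1(1+\vartheta)(1-3\lambda)+4(1-\omega_1\vartheta-\omega_2),\qquad b:=1-\omega_1[(1+\vartheta)\lambda+\vartheta]-\omega_2,$$ $$\bar\sigma:=\min\left\{\kappa,\ \frac{a-\sqrt{a^2-8b^2}}{4\gamma b}\right\}.$$ (If $\gamma=0$, then $1/\gamma$ and the second entry of the minimum are read as $+\infty$.) Let $\{x_k\}$ be generated by the INL-CondG method with $\{\theta_k\}\subset[0,\lambda^2/2]$ and $x_0\in C\cap B(x_*,\bar\sigma)\setminus\{x_*\}$, and assume that for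 every step $k$ carried out $$\|M_k^{-1}F'(x_k)\|\le\omega_1,\qquad \|M_k^{-1}F'(x_k)-I\|\le\omega_2,$$ $$\|P_kr_k\|\le\eta_k\|P_kF(x_k)\|,\qquad 0\le\eta_k\,\mathrm{cond}(P_kF'(x_k))\le\vartheta,$$ where the $P_k$ are invertible matrices and the $\eta_k$ are real numbers. Then all iterates are contained in $B(x_*,\bar\sigma)\cap C$. If the method generates an infinite sequence, then $\{x_k\}$ converges to $x_*$; if it stops at some $x_k$ because $F(x_k)=0$, then $x_k=x_*$. For every step $k$ carried out, $$\|x_{k+1}-x_*\|<\|x_k-x_*\|,$$ $$\|x_{k+1}-x_*\|\le\frac{\omega_1(1+\vartheta)(1+\lambda)\gamma}{2(1-\gamma\|x_0-x_*\|)^2-1}\,\|x_k-x_*\|^2+\big(\omega_1[(1+\vartheta)\lambda+\vartheta]+\omega_2\big)\|x_k-x_*\|.$$ If the sequence is infinite, then with $\tilde\theta=\limsup_{k\to\infty}\theta_k$, $$\limsup_{k\to\infty}\frac{\|x_{k+1}-x_*\|}{\|x_k-x_*\|}\le\omega_1\big[(1+\vartheta)\sqrt{2\tilde\theta}+\vartheta\big]+\omega_2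 .$$ -/

import Mathlib

open Filter Topology
open scoped ENNReal Nat

noncomputable section

/-- The condition number `‖A⁻¹‖ ‖A‖` of an (invertible) linear operator. -/
def condNumber {E : Type*} [NormedAddCommGroup E] [NormedSpace ℝ E] (A : E →L[ℝ] E) : ℝ :=
  ‖A.inverse‖ * ‖A‖

/-- `κ(Ω, R) = sup {t ∈ [0, R) : B(p, t) ⊆ Ω}`, an extended nonnegative number
(`R = ∞` is allowed). -/
def kappa {E : Type*} [NormedAddCommGroup E] (Ω : Set E) (p : E) (R : ℝ≥0∞) : ℝ≥0∞ :=
  sSup {t : ℝ≥0∞ | t < R ∧ Metric.eball p t ⊆ Ω}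

/-- The set of the numbers `‖F'(p)⁻¹ F⁽ᵐ⁾(p) / m!‖ ^ (1 / (m - 1))`, `m > 1`, with the operator
norm of continuous multilinear maps. -/
def smaleSet {E : Type*} [NormedAddCommGroup E] [NormedSpace ℝ E] (F : E → E) (p : E) : Set ℝ :=
  {v : ℝ | ∃ m : ℕ, 1 < m ∧
    v = ‖((m ! : ℝ)⁻¹) • ((fderiv ℝ F p).inverse.compContinuousMultilinearMap
      (iteratedFDeriv ℝ m F p))‖ ^ (1 / ((m : ℝ) - 1))}

/-- `u` is an answer of the linear optimization oracle at `z`: it minimizes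
`v ↦ ⟪z - y, v - z⟫` over `C`. -/
def IsLOSolution {E : Type*} [NormedAddCommGroup E] [InnerProductSpace ℝ E]
    (C : Set E) (y z u : E) : Prop :=
  u ∈ C ∧ ∀ v ∈ C, inner ℝ (z - y) (u - z) ≤ inner ℝ (z - y) (v - z)

/-- `CondG C y ε x w`: the conditional gradient procedure with target `y` and tolerance `ε`,
started at `x`, stops after finitely many iterations and returns `w`
(for some answers of the linear optimization oracle). -/
inductive CondG {E : Type*} [NormedAddCommGroup E] [InnerProductSpace ℝ E]
    (C : Set E) (y : E) (ε : ℝ) : E → E → Prop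
  | done (z u : E) (hu : IsLOSolution C y z u) (hg : -ε ≤ inner ℝ (z - y) (u - z)) :
      CondG C y ε z z
  | step (z u w : E) (hu : IsLOSolution C y z u) (hg : inner ℝ (z - y) (u - z) < -ε)
      (hw : CondG C y ε
        (z + (min 1 (-(inner ℝ (z - y) (u - z)) / ‖u - z‖ ^ 2)) • (u - z)) w) :
      CondG C y ε z w

/-- A run of the inexact Newton-like conditional gradient method in which the `N` steps
`0, 1, …, N - 1` are carried out, so that the iterates are `x k` for `k ≤ N`
(`N = ⊤`: an infinite sequence). A step is carried out at `x k` only if `F (x k) ≠ 0`.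
Values of the sequences beyond these indices are irrelevant. -/
structure IsINLCondGRun {E : Type*} [NormedAddCommGroup E] [InnerProductSpace ℝ E]
    (F : E → E) (C : Set E) (θ : ℕ → ℝ) (N : ℕ∞)
    (M : ℕ → (E ≃L[ℝ] E)) (x s r y : ℕ → E) : Prop where
  start_mem : x 0 ∈ C
  not_stopped : ∀ k : ℕ, (k : ℕ∞) < N → F (x k) ≠ 0
  newton : ∀ k : ℕ, (k : ℕ∞) < N → M k (s k) = -F (x k) + r k
  target : ∀ k : ℕ, (k : ℕ∞) < N → y k = x k + s k
  next : ∀ k : ℕ, (k : ℕ∞) < N → CondG C (y k) (θ k * ‖s k‖ ^ 2) (x k) (x (k + 1))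

end

/-! Normalise to `G = F'(x_*)⁻¹ F`. Its Taylor coefficients at `x_*` of order `m > 1` are at most
`γ^(m-1)`, so geometric series control `G` and `G'`. With `h = x - x_*` and `u = γ‖h‖`, one gets
`‖G'(x) - I‖ ≤ 1/(1-u)² - 1` and `‖G'(x)h - G(x)‖ ≤ γ‖h‖²/(1-u)²`. If `2(1-u)² > 1`, then `F'(x)` is
invertible and the exact Newton step has error at most `γ‖h‖²/(2(1-u)² - 1)` (`newton_bounds`). The
approximation `M` and the residual `r` add only terms linear in `‖h‖` (`inexact_newton_step`). A
point returned by `CondG` satisfies a variational inequality up to `ε`, so it is at most `√ε`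
farther from any point of `C` than the target `y` is (`CondG.norm_sub_le`). The radius is the
smaller root of the quadratic expressing that the total error factor equals 1
(`discriminant_radius_bounds`). Inside it every step contracts by a fixed `q < 1`. -/

/-! ### Majorants for the Taylor series -/

theorem FormalMultilinearSeries.norm_derivSeries_le {E F : Type*} [NormedAddCommGroup E]
    [NormedSpace ℝ E] [NormedAddCommGroup F] [NormedSpace ℝ F]
    (p : FormalMultilinearSeries ℝ E F) (n : ℕ) :
    ‖p.derivSeries n‖ ≤ (n + 1) * ‖p (n + 1)‖ := by
  have h1 : ‖p.derivSeries n‖ ≤ ‖p.changeOriginSeries 1 n‖ := by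
    refine (ContinuousLinearMap.norm_compContinuousMultilinearMap_le _ _).trans
      (mul_le_of_le_one_left (norm_nonneg _) ?_)
    exact ContinuousLinearMap.opNorm_le_bound _ zero_le_one (by simp)
  -- The series sums over the `n`-element subsets of `Fin (1 + n)`; there are `n + 1` of them.
  have h2 : ‖p.changeOriginSeries 1 n‖ ≤ (n + 1) * ‖p (1 + n)‖ := by
    have h := p.nnnorm_changeOriginSeries_le_tsum 1 n
    rw [tsum_fintype, Finset.sum_const, Finset.card_univ, Fintype.card_finset_len,
      Fintype.card_fin, Nat.choose_symm_of_eq_add (Nat.add_comm 1 n), Nat.choose_one_right, nsmul_eq_mul] at h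
    have h' : ((‖p.changeOriginSeries 1 n‖₊ : NNReal) : ℝ) ≤
        (((1 + n : ℕ) : NNReal) * ‖p (1 + n)‖₊ : NNReal) := by exact_mod_cast h
    push_cast at h'
    rw [add_comm (n : ℝ) 1]
    exact h'
  rw [Nat.add_comm n 1]
  exact h1.trans h2

section SmaleBound

variable {E : Type*} [NormedAddCommGroup E] [NormedSpace ℝ E] [CompleteSpace E]

/-- The Taylor series of `G` at `p`. -/
noncomputable def taylorFormalSeries {E : Type*} [NormedAddCommGroup E] [NormedSpace ℝ E] (G : E → E) (p : E) :
    FormalMultilinearSeries ℝ E E :=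
  fun m => ((m ! : ℝ)⁻¹) • iteratedFDeriv ℝ m G p

theorem HasFPowerSeriesOnBall.hasSum_taylorFormalSeries {G : E → E}
    {q : FormalMultilinearSeries ℝ E E} {p h : E} {r : ℝ≥0∞}
    (hG : HasFPowerSeriesOnBall G q p r) (hh : h ∈ Metric.eball (0 : E) r) :
    HasSum (fun m => taylorFormalSeries G p m fun _ => h) (G (p + h)) :=
  hG.hasSum_iteratedFDeriv hh

omit [CompleteSpace E] in
theorem le_radius_of_geometric_bound {q : FormalMultilinearSeries ℝ E E} {γ : ℝ} (hγ : 0 ≤ γ)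
    (hq : ∀ m, 1 < m → ‖q m‖ ≤ γ ^ (m - 1)) : 1 / ENNReal.ofReal γ ≤ q.radius := by
  refine ENNReal.le_of_forall_nnreal_lt fun r hr => ?_
  have hr1 : γ * r ≤ 1 := by
    have h1 : (r : ℝ≥0∞) * ENNReal.ofReal γ ≤ 1 := ENNReal.mul_le_of_le_div hr.le
    rw [← ENNReal.ofReal_coe_nnreal, ← ENNReal.ofReal_mul r.coe_nonneg, ENNReal.ofReal_le_one] at h1
    linarith [mul_comm γ r]
  refine q.le_radius_of_bound (‖q 0‖ + ‖q 1‖ * r + r) fun m => ?_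
  have h0 := norm_nonneg (q 0)
  have h1 : 0 ≤ ‖q 1‖ * r := by positivity
  have h2 : (0 : ℝ) ≤ r := r.2
  match m with
  | 0 => simp; linarith
  | 1 => simp only [pow_one]; linarith
  | k + 2 =>
    have h3 : ‖q (k + 2)‖ * (r : ℝ) ^ (k + 2) ≤ γ ^ (k + 1) * (r : ℝ) ^ (k + 2) := by
      gcongr
      exact hq (k + 2) (by omega)
    have h4 : γ ^ (k + 1) * (r : ℝ) ^ (k + 2) = (γ * r) ^ (k + 1) * r := by ring
    have h5 : (γ * r) ^ (k + 1) ≤ 1 := pow_le_one₀ (by positivity) hr1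
    nlinarith

/-- Real analyticity on a ball does not make the Taylor series converge there. Given the radius, the
sum agrees with `G` near `p`, hence on the whole connected ball by the identity theorem. -/
theorem hasFPowerSeriesOnBall_taylorFormalSeries {G : E → E} {p : E} {R : ℝ≥0∞} (hR : 0 < R)
    (hG : AnalyticOnNhd ℝ G (Metric.eball p R)) (hrad : R ≤ (taylorFormalSeries G p).radius) :
    HasFPowerSeriesOnBall G (taylorFormalSeries G p) p R := by
  set q := taylorFormalSeries G p
  have hsum : HasFPowerSeriesOnBall (fun z => q.sum (z - p)) q p R := by
    have h := ((q.hasFPowerSeriesOnBall (hR.trans_le hrad)).mono hR hrad).comp_sub p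
    rwa [zero_add] at h
  refine hsum.congr (hsum.analyticOnNhd.eqOn_of_preconnected_of_eventuallyEq hG
    Metric.isPreconnected_eball (Metric.mem_eball_self hR) ?_)
  obtain ⟨q', r, hq'⟩ := hG p (Metric.mem_eball_self hR)
  filter_upwards [Metric.eball_mem_nhds p hq'.r_pos] with z hz
  have hz' : z - p ∈ Metric.eball (0 : E) r := by
    simpa [Metric.mem_eball, edist_eq_enorm_sub] using hz
  have h := hq'.hasSum_taylorFormalSeries hz'
  rw [add_sub_cancel] at h
  exact h.tsum_eq

/-- `G` behaves like a perturbation of `z ↦ z - p` on a ball, with perturbation controlled by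
Smale's majorant. -/
theorem smale_bounds {G : E → E} {p : E} {R : ℝ≥0∞} {γ : ℝ} (hγ : 0 ≤ γ)
    (hG : AnalyticOnNhd ℝ G (Metric.eball p R)) (hRγ : R ≤ 1 / ENNReal.ofReal γ)
    (hG0 : G p = 0) (hG1 : fderiv ℝ G p = ContinuousLinearMap.id ℝ E)
    (hsm : ∀ m, 1 < m → ‖((m ! : ℝ)⁻¹) • iteratedFDeriv ℝ m G p‖ ≤ γ ^ (m - 1))
    {h : E} (hh : ‖h‖ₑ < R) :
    γ * ‖h‖ < 1 ∧
    ‖fderiv ℝ G (p + h) - ContinuousLinearMap.id ℝ E‖ ≤ 1 / (1 - γ * ‖h‖) ^ 2 - 1 ∧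
    ‖G (p + h) - h‖ ≤ γ * ‖h‖ ^ 2 / (1 - γ * ‖h‖) ∧
    ‖fderiv ℝ G (p + h) h - G (p + h)‖ ≤ γ * ‖h‖ ^ 2 / (1 - γ * ‖h‖) ^ 2 := by
  have hR : 0 < R := (zero_le).trans_lt hh
  set q := taylorFormalSeries G p with hqdef
  have hq : HasFPowerSeriesOnBall G q p R := hasFPowerSeriesOnBall_taylorFormalSeries hR hG
    (hRγ.trans (le_radius_of_geometric_bound hγ hsm))
  set u := γ * ‖h‖ with hu
  have hu0 : 0 ≤ u := by positivity
  have hu1 : u < 1 := by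
    by_contra! hcon
    have h1 : 1 / ENNReal.ofReal γ ≤ ‖h‖ₑ := by
      have hγ' : 0 < γ := by
        rcases hγ.eq_or_lt with h0 | h0
        · rw [hu, ← h0] at hcon; norm_num at hcon
        · exact h0
      refine ENNReal.div_le_of_le_mul ?_
      rw [← ofReal_norm, ← ENNReal.ofReal_mul (norm_nonneg _), mul_comm,
        ENNReal.one_le_ofReal]
      exact hcon
    exact absurd (hh.trans_le hRγ) (not_lt.mpr h1)
  have hmem : h ∈ Metric.eball (0 : E) R := by simpa [Metric.mem_eball] using hh
  have hu1' : 1 - u ≠ 0 := by linarith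
  have hnu : ‖u‖ < 1 := by rwa [Real.norm_of_nonneg hu0]
  have hgeo := hasSum_geometric_of_lt_one hu0 hu1
  have hcoe := hasSum_coe_mul_geometric_of_norm_lt_one hnu
  have hterm : ∀ (m : ℕ) , ‖q (m + 2) fun _ => h‖ ≤ γ ^ (m + 1) * ‖h‖ ^ (m + 2) := fun m =>
    ((q (m + 2)).le_opNorm_mul_pow_of_le (pi_norm_const_le h)).trans (by
      gcongr
      · exact hsm (m + 2) (by omega))
  have hq0 : (q 0 fun _ => h) = 0 := by
    have := hq.coeff_zero (fun _ => h)
    rw [this, hG0]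
  have hq1 : (q 1 fun _ => h) = h := by
    simp [hqdef, taylorFormalSeries, iteratedFDeriv_one_apply, hG1]
  have hsG := hq.hasSum hmem
  have hsD := hq.fderiv.hasSum hmem
  refine ⟨hu1, ?_, ?_, ?_⟩
  · have hd0 : (q.derivSeries 0 fun _ => h) = ContinuousLinearMap.id ℝ E := by
      rw [← hG1]; exact hq.fderiv.coeff_zero _
    have h1 := (hasSum_nat_add_iff' 1).mpr hsD
    rw [Finset.sum_range_one, hd0] at h1
    -- `∑ (m + 1) u^m = 1 / (1 - u)²`, without its zeroth term.
    have h2 : HasSum (fun m : ℕ => ((m + 1 : ℕ) : ℝ) * u ^ (m + 1) + u ^ (m + 1))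
        (1 / (1 - u) ^ 2 - 1) := by
      have h3 := (hasSum_nat_add_iff' 1).mpr (hcoe.add hgeo)
      convert! h3 using 1
      simp
      field_simp
      ring
    refine h1.norm_le_of_bounded h2 fun m => ?_
    refine ((q.derivSeries (m + 1)).le_opNorm_mul_pow_of_le (pi_norm_const_le h)).trans ?_
    have h4 := q.norm_derivSeries_le (m + 1)
    have h5 := hsm (m + 1 + 1) (by omega)
    have h6 : ‖q (m + 1 + 1)‖ ≤ γ ^ (m + 1) := h5
    calc ‖q.derivSeries (m + 1)‖ * ‖h‖ ^ (m + 1)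
        ≤ (((m + 1 : ℕ) : ℝ) + 1) * γ ^ (m + 1) * ‖h‖ ^ (m + 1) := by
          gcongr
          exact h4.trans (by gcongr)
      _ = _ := by rw [hu]; ring
  · have h1 := (hasSum_nat_add_iff' 2).mpr hsG
    rw [Finset.sum_range_succ, Finset.sum_range_one, hq0, hq1, zero_add] at h1
    have h2 := hgeo.mul_left (γ * ‖h‖ ^ 2)
    rw [← div_eq_mul_inv] at h2
    refine h1.norm_le_of_bounded h2 fun m => (hterm m).trans_eq ?_
    rw [hu]; ring
  · have h1 := (hasSum_nat_add_iff' 1).mpr hsG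
    rw [Finset.sum_range_one, hq0, sub_zero] at h1
    -- The difference is `∑ (m - 1) q_m(h, …, h)`, so the linear term cancels. After the index shift
    -- the majorant is `‖h‖ ∑ m u^m`.
    have h2 : HasSum (fun m => (m + 1) • q (m + 1) fun _ => h) (fderiv ℝ G (p + h) h) := by
      have h3 := (ContinuousLinearMap.apply ℝ E h).hasSum hsD
      simpa only [ContinuousLinearMap.apply_apply, q.derivSeries_apply_diag] using h3
    have h4 := h2.sub h1
    have h5 := hcoe.mul_left ‖h‖
    have h6 : ‖h‖ * (u / (1 - u) ^ 2) = γ * ‖h‖ ^ 2 / (1 - u) ^ 2 := by rw [hu]; ring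
    rw [h6] at h5
    refine h4.norm_le_of_bounded h5 fun m => ?_
    match m with
    | 0 => simp
    | k + 1 =>
      have h7 : (k + 1 + 1) • (q (k + 1 + 1) fun _ => h) - (q (k + 1 + 1) fun _ => h) =
          ((k + 1 : ℕ) : ℝ) • (q (k + 1 + 1) fun _ => h) := by
        rw [succ_nsmul, add_sub_cancel_right, Nat.cast_smul_eq_nsmul]
      rw [h7, norm_smul, Real.norm_natCast]
      calc ((k + 1 : ℕ) : ℝ) * ‖q (k + 1 + 1) fun _ => h‖
          ≤ ((k + 1 : ℕ) : ℝ) * (γ ^ (k + 1) * ‖h‖ ^ (k + 2)) := by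
            gcongr
            exact hterm k
        _ = _ := by rw [hu]; ring

end SmaleBound

/-! ### Invertibility of the derivative and the exact Newton step -/

theorem ContinuousLinearMap.exists_equiv_of_norm_sub_id_lt_one {E : Type*} [NormedAddCommGroup E]
    [NormedSpace ℝ E] [CompleteSpace E] {T : E →L[ℝ] E}
    (hT : ‖T - ContinuousLinearMap.id ℝ E‖ < 1) : ∃ e : E ≃L[ℝ] E, (e : E →L[ℝ] E) = T := by
  have h1 : ‖(1 : E →L[ℝ] E) - T‖ < 1 := by rwa [norm_sub_rev]
  refine ⟨ContinuousLinearEquiv.unitsEquiv ℝ E (Units.oneSub (1 - T) h1), ?_⟩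
  ext v
  simp

section NewtonBounds

variable {E : Type*} [NormedAddCommGroup E] [NormedSpace ℝ E] [CompleteSpace E]

theorem smaleSet_isLUB_nonneg {E : Type*} [NormedAddCommGroup E] [NormedSpace ℝ E] {F : E → E}
    {p : E} {γ : ℝ} (hγ : IsLUB (smaleSet F p) γ) : 0 ≤ γ :=
  (Real.rpow_nonneg (norm_nonneg _) _).trans (hγ.1 ⟨2, one_lt_two, rfl⟩)

theorem smaleSet_norm_le_pow {E : Type*} [NormedAddCommGroup E] [NormedSpace ℝ E] {F : E → E}
    {p : E} {γ : ℝ} (hγ : IsLUB (smaleSet F p) γ) {m : ℕ} (hm : 1 < m) :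
    ‖((m ! : ℝ)⁻¹) • ((fderiv ℝ F p).inverse.compContinuousMultilinearMap
      (iteratedFDeriv ℝ m F p))‖ ≤ γ ^ (m - 1) := by
  set c := ‖((m ! : ℝ)⁻¹) • ((fderiv ℝ F p).inverse.compContinuousMultilinearMap
      (iteratedFDeriv ℝ m F p))‖
  have hc : 0 ≤ c := norm_nonneg _
  have h1 : c ^ (1 / ((m : ℝ) - 1)) ≤ γ := hγ.1 ⟨m, hm, rfl⟩
  have h2 : ((m - 1 : ℕ) : ℝ) = (m : ℝ) - 1 := by rw [Nat.cast_sub hm.le, Nat.cast_one]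
  have h3 : (c ^ (1 / ((m : ℝ) - 1))) ^ (m - 1) = c := by
    rw [← h2, one_div]
    exact Real.rpow_inv_natCast_pow hc (by omega)
  rw [← h3]
  exact pow_le_pow_left₀ (Real.rpow_nonneg hc _) h1 _

/-- Smale's estimates for `F` at a nondegenerate zero `p`: local uniqueness of the zero and the
error of the exact Newton step. -/
theorem newton_bounds {F : E → E} {p : E} {R : ℝ≥0∞} {γ : ℝ} (hγ : IsLUB (smaleSet F p) γ)
    (hF : AnalyticOnNhd ℝ F (Metric.eball p R)) (hRγ : R ≤ 1 / ENNReal.ofReal γ)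
    (hF0 : F p = 0) (hF1 : (fderiv ℝ F p).IsInvertible) {x : E} (hx : ‖x - p‖ₑ < R) :
    (γ * ‖x - p‖ < 1 / 2 → F x = 0 → x = p) ∧
    (0 < 2 * (1 - γ * ‖x - p‖) ^ 2 - 1 → ∃ B : E ≃L[ℝ] E, (B : E →L[ℝ] E) = fderiv ℝ F x ∧
      ‖B.symm (F x) - (x - p)‖ ≤
        γ * ‖x - p‖ ^ 2 / (2 * (1 - γ * ‖x - p‖) ^ 2 - 1)) := by
  have hγ0 := smaleSet_isLUB_nonneg hγ
  obtain ⟨A, hA⟩ := hF1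
  have hpR : p ∈ Metric.eball p R := Metric.mem_eball_self (zero_le.trans_lt hx)
  have hxR : x ∈ Metric.eball p R := by rwa [Metric.mem_eball, edist_eq_enorm_sub]
  have hsm := fun m hm => smaleSet_norm_le_pow hγ (m := m) hm
  rw [← hA, ContinuousLinearMap.inverse_equiv] at hsm
  simp_rw [← A.symm.iteratedFDeriv_comp_left] at hsm
  have hd : ∀ z ∈ Metric.eball p R, fderiv ℝ (A.symm ∘ F) z =
      (A.symm : E →L[ℝ] E) ∘L fderiv ℝ F z := fun z _ => A.symm.comp_fderiv
  have hG : AnalyticOnNhd ℝ (A.symm ∘ F) (Metric.eball p R) :=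
    (A.symm : E →L[ℝ] E).comp_analyticOnNhd hF
  have hG1 : fderiv ℝ (A.symm ∘ F) p = ContinuousLinearMap.id ℝ E := by
    rw [hd p hpR, ← hA]; ext v; simp
  obtain ⟨hu1, hb1, hb2, hb3⟩ := smale_bounds hγ0 hG hRγ (by simp [hF0]) hG1 hsm hx
  rw [add_sub_cancel] at hb1 hb2 hb3
  rw [hd x hxR] at hb1 hb3
  simp only [Function.comp_apply] at hb2 hb3
  set t := ‖x - p‖ with ht
  have ht0 : 0 ≤ t := norm_nonneg _
  refine ⟨fun hhalf hFx => ?_, fun hD => ?_⟩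
  -- At a zero of `F` the bound reads `t (1 - 2γt) ≤ 0`.
  · rw [hFx, map_zero, zero_sub, norm_neg, ← ht, le_div_iff₀ (by linarith)] at hb2
    have h0 : t = 0 := by nlinarith
    exact sub_eq_zero.mp (norm_eq_zero.mp h0)
  · have hs : 0 < (1 - γ * t) ^ 2 := by
      have : 0 < 1 - γ * t := by linarith
      positivity
    have hδ : 1 / (1 - γ * t) ^ 2 - 1 < 1 := by
      have : 1 / (1 - γ * t) ^ 2 < 2 := by rw [div_lt_iff₀ hs]; linarith
      linarith
    obtain ⟨T, hT⟩ := ContinuousLinearMap.exists_equiv_of_norm_sub_id_lt_one (hb1.trans_lt hδ)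
    have hB : ((T.trans A : E ≃L[ℝ] E) : E →L[ℝ] E) = fderiv ℝ F x := by
      ext v
      have := congrArg (fun S : E →L[ℝ] E => A (S v)) hT
      simpa using this
    refine ⟨T.trans A, hB, ?_⟩
    set v := (T.trans A).symm (F x) - (x - p) with hv
    rw [← hT] at hb1 hb3
    have hTv : T v = A.symm (F x) - T (x - p) := by
      rw [hv, map_sub]; simp
    have h1 : ‖T v‖ ≤ γ * t ^ 2 / (1 - γ * t) ^ 2 := by
      rw [hTv, norm_sub_rev]; exact hb3
    -- Absorbing the last term leaves `(2 - 1/(1-γt)²) ‖v‖ ≤ ‖T v‖`; multiplying by `(1-γt)²`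
    -- produces the denominator `2(1-γt)² - 1`.
    have h2 : ‖v‖ ≤ ‖T v‖ + (1 / (1 - γ * t) ^ 2 - 1) * ‖v‖ := by
      have h3 := ((T : E →L[ℝ] E) - ContinuousLinearMap.id ℝ E).le_of_opNorm_le hb1 v
      have h4 : v = T v - ((T : E →L[ℝ] E) - ContinuousLinearMap.id ℝ E) v := by simp
      calc ‖v‖ = ‖T v - ((T : E →L[ℝ] E) - ContinuousLinearMap.id ℝ E) v‖ := by rw [← h4]
        _ ≤ _ := (norm_sub_le _ _).trans (by linarith)
    rw [le_div_iff₀ hD]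
    rw [le_div_iff₀ hs] at h1
    have h5 : (1 / (1 - γ * t) ^ 2) * (1 - γ * t) ^ 2 = 1 := div_mul_cancel₀ 1 hs.ne'
    have h6 := mul_le_mul_of_nonneg_right h2 hs.le
    have h7 : (‖T v‖ + (1 / (1 - γ * t) ^ 2 - 1) * ‖v‖) * (1 - γ * t) ^ 2 =
        ‖T v‖ * (1 - γ * t) ^ 2 +
          (1 / (1 - γ * t) ^ 2 * (1 - γ * t) ^ 2 - (1 - γ * t) ^ 2) * ‖v‖ := by ring
    rw [h7, h5] at h6
    linarith

end NewtonBounds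

/-! ### Inexact Newton-like steps -/

/-- With `Q = P B`, `B⁻¹ r = Q⁻¹ (P r)` and `P f = Q (B⁻¹ f)`, so removing the preconditioner costs
exactly the factor `cond Q`. -/
theorem residual_bound {E : Type*} [NormedAddCommGroup E] [NormedSpace ℝ E]
    {B P : E ≃L[ℝ] E} {f r : E} {η ϑ : ℝ} (hϑ : 0 ≤ ϑ) (hr : ‖P r‖ ≤ η * ‖P f‖)
    (hη : η * condNumber ((P : E →L[ℝ] E) ∘L (B : E →L[ℝ] E)) ≤ ϑ) :
    ‖B.symm r‖ ≤ ϑ * ‖B.symm f‖ := by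
  set Q : E ≃L[ℝ] E := B.trans P with hQ
  have hcoe : (P : E →L[ℝ] E) ∘L (B : E →L[ℝ] E) = (Q : E →L[ℝ] E) := rfl
  rw [hcoe, condNumber, ContinuousLinearMap.inverse_equiv] at hη
  have h1 : B.symm r = (Q.symm : E →L[ℝ] E) (P r) := by simp [hQ]
  have h2 : P f = (Q : E →L[ℝ] E) (B.symm f) := by simp [hQ]
  have h3 : ‖B.symm r‖ ≤ ‖(Q.symm : E →L[ℝ] E)‖ * ‖P r‖ := h1 ▸ ContinuousLinearMap.le_opNorm _ _
  have h4 : ‖P f‖ ≤ ‖(Q : E →L[ℝ] E)‖ * ‖B.symm f‖ := h2 ▸ ContinuousLinearMap.le_opNorm _ _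
  -- `η` has no assumed sign; `η ≤ 0` forces `P r = 0`.
  rcases le_total 0 η with h0 | h0
  · calc ‖B.symm r‖ ≤ ‖(Q.symm : E →L[ℝ] E)‖ * (η * (‖(Q : E →L[ℝ] E)‖ * ‖B.symm f‖)) :=
          h3.trans (by gcongr; exact hr.trans (by gcongr))
      _ = (η * (‖(Q.symm : E →L[ℝ] E)‖ * ‖(Q : E →L[ℝ] E)‖)) * ‖B.symm f‖ := by ring
      _ ≤ ϑ * ‖B.symm f‖ := by gcongr
  · have h5 : ‖P r‖ ≤ 0 := hr.trans (mul_nonpos_of_nonpos_of_nonneg h0 (norm_nonneg _))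
    have h6 : ‖B.symm r‖ ≤ 0 :=
      h3.trans (mul_nonpos_of_nonneg_of_nonpos (norm_nonneg _) h5)
    exact h6.trans (by positivity)

/-- One inexact Newton-like step: `h` is the error of the current iterate, `s` the step. -/
theorem inexact_newton_step {E : Type*} [NormedAddCommGroup E] [NormedSpace ℝ E]
    {B M P : E ≃L[ℝ] E} {f r s h : E} {η ϑ ω₁ ω₂ e : ℝ} (hϑ : 0 ≤ ϑ) (hs : M s = -f + r)
    (hM₁ : ‖(M.symm : E →L[ℝ] E) ∘L (B : E →L[ℝ] E)‖ ≤ ω₁)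
    (hM₂ : ‖(M.symm : E →L[ℝ] E) ∘L (B : E →L[ℝ] E) - ContinuousLinearMap.id ℝ E‖ ≤ ω₂)
    (hr : ‖P r‖ ≤ η * ‖P f‖)
    (hη : η * condNumber ((P : E →L[ℝ] E) ∘L (B : E →L[ℝ] E)) ≤ ϑ)
    (he : ‖B.symm f - h‖ ≤ e) :
    ‖s‖ ≤ ω₁ * (1 + ϑ) * (e + ‖h‖) ∧
      ‖h + s‖ ≤ ω₁ * (1 + ϑ) * e + (ω₁ * ϑ + ω₂) * ‖h‖ := by
  have hω₁ : 0 ≤ ω₁ := (norm_nonneg _).trans hM₁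
  set S : E →L[ℝ] E := (M.symm : E →L[ℝ] E) ∘L (B : E →L[ℝ] E) with hS
  have hres := residual_bound hϑ hr hη
  have hn : ‖B.symm f‖ ≤ e + ‖h‖ := by
    have := norm_add_le (B.symm f - h) h
    rw [sub_add_cancel] at this
    linarith
  have hs' : s = S (-(B.symm f) + B.symm r) := by
    have : s = M.symm (-f + r) := by rw [← hs, M.symm_apply_apply]
    simp [hS, this]
  have hres' : ‖B.symm r‖ ≤ ϑ * (e + ‖h‖) := hres.trans (by gcongr)
  constructor
  · have h1 : ‖-(B.symm f) + B.symm r‖ ≤ (1 + ϑ) * (e + ‖h‖) := by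
      refine (norm_add_le _ _).trans ?_
      rw [norm_neg]
      linarith
    rw [hs', mul_assoc]
    exact (S.le_of_opNorm_le hM₁ _).trans (by gcongr)
  · have h1 : h + s = S (-(B.symm f - h) + B.symm r) - (S - ContinuousLinearMap.id ℝ E) h := by
      rw [hs']
      simp only [map_add, map_neg, map_sub, sub_apply, ContinuousLinearMap.id_apply]
      abel
    have h2 : ‖-(B.symm f - h) + B.symm r‖ ≤ e + ϑ * (e + ‖h‖) := by
      refine (norm_add_le _ _).trans ?_
      rw [norm_neg]
      linarith
    rw [h1]
    calc _ ≤ ω₁ * (e + ϑ * (e + ‖h‖)) + ω₂ * ‖h‖ :=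
          (norm_sub_le _ _).trans (add_le_add
            ((S.le_of_opNorm_le hM₁ _).trans (by gcongr)) ((_ : E →L[ℝ] E).le_of_opNorm_le hM₂ _))
      _ = _ := by ring

/-! ### The conditional gradient procedure -/

section CondGradient

variable {E : Type*} [NormedAddCommGroup E] [InnerProductSpace ℝ E] {C : Set E} {y x w : E} {ε : ℝ}

theorem CondG.mem (h : CondG C y ε x w) (hC : Convex ℝ C) (hε : 0 ≤ ε) (hx : x ∈ C) : w ∈ C := by
  induction h with
  | done z u hu hg => exact hx
  | step z u w hu hg hw ih =>
    refine ih (hC.add_smul_sub_mem hx hu.1 ⟨le_min zero_le_one ?_, min_le_left _ _⟩)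
    exact div_nonneg (by linarith) (by positivity)

theorem CondG.inner_ge (h : CondG C y ε x w) {v : E} (hv : v ∈ C) :
    -ε ≤ inner ℝ (w - y) (v - w) := by
  induction h with
  | done z u hu hg => exact hg.trans (hu.2 v hv)
  | step z u w hu hg hw ih => exact ih

/-- Testing the stopping inequality at `p` gives `‖w-p‖² ≤ ‖y-p‖ ‖w-p‖ + δ²`, which fails once
`‖w-p‖ > ‖y-p‖ + δ`. -/
theorem CondG.norm_sub_le (h : CondG C y ε x w) {p : E} (hp : p ∈ C) {δ : ℝ} (hδ : 0 ≤ δ)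
    (hε : ε ≤ δ ^ 2) : ‖w - p‖ ≤ ‖y - p‖ + δ := by
  have h1 := h.inner_ge hp
  have h2 : inner ℝ (w - y) (p - w) = inner ℝ (y - p) (w - p) - ‖w - p‖ ^ 2 := by
    rw [← real_inner_self_eq_norm_sq, ← inner_sub_left, ← neg_sub w p, inner_neg_right,
      ← inner_neg_left]
    congr 1
    abel
  have h3 := real_inner_le_norm (y - p) (w - p)
  have h4 := norm_nonneg (y - p)
  by_contra! hcon
  nlinarith

end CondGradient

/-! ### The convergence radius and limit arguments -/

/-- The last inequality is `2bu² - au + b > 0`, which holds below the smaller root `(a - √(a² -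
8b²)) / (4b)`. -/
theorem discriminant_radius_bounds {W lam a b u : ℝ} (hW : 0 ≤ W) (hlam : 0 ≤ lam) (hb : 0 < b)
    (ha : a = W * (1 + lam) + 4 * b) (hu : 0 ≤ u) (hur : 4 * b * u < a - √(a ^ 2 - 8 * b ^ 2)) :
    u < 1 / 2 ∧ 0 < 2 * (1 - u) ^ 2 - 1 ∧ W * (1 + lam) * u < b * (2 * (1 - u) ^ 2 - 1) := by
  have hWl : 0 ≤ W * (1 + lam) := by positivity
  have hab : 4 * b ≤ a := by linarith
  have hdisc : 0 ≤ a ^ 2 - 8 * b ^ 2 := by nlinarith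
  set r := √(a ^ 2 - 8 * b ^ 2)
  have hr0 : 0 ≤ r := Real.sqrt_nonneg _
  have hr : r ^ 2 = a ^ 2 - 8 * b ^ 2 := Real.sq_sqrt hdisc
  have hhalf : u < 1 / 2 := by
    by_contra! hcon
    have h1 : r < a - 2 * b := by nlinarith
    nlinarith
  have hq : 0 < 2 * b * u ^ 2 - a * u + b := by
    have h1 : r ^ 2 < (a - 4 * b * u) ^ 2 := by
      apply pow_lt_pow_left₀ (by linarith) hr0 (by norm_num)
    have h2 : 0 < 8 * b * (2 * b * u ^ 2 - a * u + b) := by nlinarith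
    exact pos_of_mul_pos_right h2 (by positivity)
  have hlast : W * (1 + lam) * u < b * (2 * (1 - u) ^ 2 - 1) := by
    rw [ha] at hq
    nlinarith
  refine ⟨hhalf, ?_, hlast⟩
  exact pos_of_mul_pos_right ((mul_nonneg hWl hu).trans_lt hlast) hb.le

theorem tendsto_zero_of_le_mul {t : ℕ → ℝ} {q : ℝ} (ht : ∀ k, 0 ≤ t k) (hq0 : 0 ≤ q) (hq1 : q < 1)
    (h : ∀ k, t (k + 1) ≤ q * t k) : Tendsto t atTop (𝓝 0) := by
  have hk : ∀ k, t k ≤ q ^ k * t 0 := fun k => by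
    induction k with
    | zero => simp
    | succ k ih =>
      calc t (k + 1) ≤ q * t k := h k
        _ ≤ q * (q ^ k * t 0) := by gcongr
        _ = _ := by ring
  refine squeeze_zero ht hk ?_
  simpa using (tendsto_pow_atTop_nhds_zero_of_lt_one hq0 hq1).mul_const (t 0)

/-- The limit superior of ratios dominated by `K t + g (√(2 θ))` with `t → 0`. -/
theorem limsup_le_of_le_add_sqrt {ρ t θ : ℕ → ℝ} {K c d B : ℝ} (hc : 0 ≤ c)
    (ht : Tendsto t atTop (𝓝 0)) (hρ0 : ∀ k, 0 ≤ ρ k) (hθB : ∀ k, θ k ≤ B)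
    (hρ : ∀ k, ρ k ≤ K * t k + (c * √(2 * θ k) + d)) :
    limsup ρ atTop ≤ c * √(2 * limsup θ atTop) + d := by
  have hbdd : IsBoundedUnder (· ≤ ·) atTop θ := isBoundedUnder_of ⟨B, hθB⟩
  -- Any `z` above the limsup eventually bounds `θ`; letting `z` decrease to it, continuity gives
  -- the claim.
  have hlim : ∀ z, limsup θ atTop < z → limsup ρ atTop ≤ c * √(2 * z) + d := by
    intro z hz
    have h1 : Tendsto (fun k => K * t k + (c * √(2 * z) + d)) atTop
        (𝓝 (c * √(2 * z) + d)) := by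
      simpa using (ht.const_mul K).add_const (c * √(2 * z) + d)
    rw [← h1.limsup_eq]
    refine limsup_le_limsup ?_ (isCoboundedUnder_le_of_le atTop hρ0) h1.isBoundedUnder_le
    filter_upwards [eventually_lt_of_limsup_lt hz hbdd] with k hk
    refine (hρ k).trans ?_
    gcongr
  have hcont : Tendsto (fun z => c * √(2 * z) + d) (𝓝[>] (limsup θ atTop))
      (𝓝 (c * √(2 * limsup θ atTop) + d)) := by
    refine Tendsto.mono_left ?_ nhdsWithin_le_nhds
    exact (by fun_prop : Continuous fun z : ℝ => c * √(2 * z) + d).tendsto _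
  exact ge_of_tendsto hcont (eventually_nhdsWithin_of_forall hlim)

theorem exists_radius_of_lt_kappa {E : Type*} [NormedAddCommGroup E] {Ω : Set E} {p x : E}
    {R : ℝ≥0∞} (hx : edist x p < kappa Ω p R) :
    ∃ t : ℝ≥0∞, t ≤ R ∧ Metric.eball p t ⊆ Ω ∧ ‖x - p‖ₑ < t := by
  obtain ⟨t, ⟨ht, hΩ⟩, hxt⟩ := lt_sSup_iff.mp hx
  exact ⟨t, ht.le, hΩ, by rwa [← edist_eq_enorm_sub]⟩

/-- When `γ = 0` the quotient is `∞` and the conclusion reduces to `0 < c`. -/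
theorem mul_lt_of_edist_lt_div {E : Type*} [NormedAddCommGroup E] {x p : E} {c γ b : ℝ}
    (hc : 0 < c)
    (hx : edist x p < ENNReal.ofReal c / ENNReal.ofReal (4 * γ * b)) :
    4 * b * (γ * ‖x - p‖) < c := by
  have h1 : ‖x - p‖ₑ * ENNReal.ofReal (4 * γ * b) < ENNReal.ofReal c := by
    rw [← edist_eq_enorm_sub]
    exact ENNReal.mul_lt_of_lt_div hx
  rw [← ofReal_norm, ← ENNReal.ofReal_mul (norm_nonneg _), ENNReal.ofReal_lt_ofReal_iff hc] at h1
  linarith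

/-! ### Error of one full step -/

section Step

variable {E : Type*} [NormedAddCommGroup E] [InnerProductSpace ℝ E]

/-- Error after one step of the inexact Newton-like conditional gradient method, for a step whose
tolerance is at most `τ² ‖s‖² / 2`. -/
theorem inlCondG_step_error {C : Set E} {p x x' y s r f : E} {B M P : E ≃L[ℝ] E}
    {θ η ϑ ω₁ ω₂ e τ : ℝ} (hp : p ∈ C) (hϑ : 0 ≤ ϑ) (hs : M s = -f + r) (hy : y = x + s)
    (hM₁ : ‖(M.symm : E →L[ℝ] E) ∘L (B : E →L[ℝ] E)‖ ≤ ω₁)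
    (hM₂ : ‖(M.symm : E →L[ℝ] E) ∘L (B : E →L[ℝ] E) - ContinuousLinearMap.id ℝ E‖ ≤ ω₂)
    (hr : ‖P r‖ ≤ η * ‖P f‖)
    (hη : η * condNumber ((P : E →L[ℝ] E) ∘L (B : E →L[ℝ] E)) ≤ ϑ)
    (he : ‖B.symm f - (x - p)‖ ≤ e) (hτ : 0 ≤ τ) (hθτ : θ ≤ τ ^ 2 / 2)
    (hx' : CondG C y (θ * ‖s‖ ^ 2) x x') :
    ‖x' - p‖ ≤ ω₁ * (1 + ϑ) * (1 + τ) * e +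
      (ω₁ * ((1 + ϑ) * τ + ϑ) + ω₂) * ‖x - p‖ := by
  obtain ⟨h1, h2⟩ := inexact_newton_step hϑ hs hM₁ hM₂ hr hη he
  have h3 : ‖x' - p‖ ≤ ‖y - p‖ + τ * ‖s‖ := by
    -- Only `θ ≤ τ²` is needed here; the factor `1/2` is slack.
    refine hx'.norm_sub_le hp (by positivity) ?_
    rw [mul_pow]
    gcongr
    nlinarith [sq_nonneg τ]
  have h4 : y - p = x - p + s := by rw [hy]; abel
  rw [h4] at h3
  have h5 : τ * ‖s‖ ≤ τ * (ω₁ * (1 + ϑ) * (e + ‖x - p‖)) := by gcongr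
  linarith

end Step

/-! ### Local convergence theorem -/

theorem mainTheorem3 (n : ℕ)
    (Ω C : Set (EuclideanSpace ℝ (Fin n)))
    (F : EuclideanSpace ℝ (Fin n) → EuclideanSpace ℝ (Fin n))
    (xs : EuclideanSpace ℝ (Fin n))
    (hΩ : IsOpen Ω) (hCconv : Convex ℝ C) (hCcomp : IsCompact C) (hCΩ : C ⊆ Ω)
    (hxsC : xs ∈ C) (hFxs : F xs = 0) (hF'xs : (fderiv ℝ F xs).IsInvertible)
    (hF : AnalyticOnNhd ℝ F Ω)
    -- `γ` is the (finite) supremum in the Smale condition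
    (γ : ℝ) (hγ : IsLUB (smaleSet F xs) γ)
    (ϑ ω₁ ω₂ lam : ℝ)
    (hϑ0 : 0 ≤ ϑ) (hϑ1 : ϑ < 1) (hω₂ : 0 ≤ ω₂) (hω : ω₂ < ω₁) (hωϑ : ω₁ * ϑ + ω₂ < 1)
    (hlam0 : 0 ≤ lam) (hlam1 : lam < (1 - ω₂ - ω₁ * ϑ) / (ω₁ * (1 + ϑ)))
    (a b : ℝ)
    (ha : a = ω₁ * (1 + ϑ) * (1 - 3 * lam) + 4 * (1 - ω₁ * ϑ - ω₂))
    (hb : b = 1 - ω₁ * ((1 + ϑ) * lam + ϑ) - ω₂)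
    -- `σ = min {κ(Ω, 1/γ), (a - √(a² - 8b²)) / (4γb)}`, where `c / 0 = ∞` for `c > 0`
    (σ : ℝ≥0∞)
    (hσ : σ = min (kappa Ω xs (1 / ENNReal.ofReal γ))
      (ENNReal.ofReal (a - √(a ^ 2 - 8 * b ^ 2)) / ENNReal.ofReal (4 * γ * b)))
    (N : ℕ∞) (θ : ℕ → ℝ)
    (M P : ℕ → (EuclideanSpace ℝ (Fin n) ≃L[ℝ] EuclideanSpace ℝ (Fin n)))
    (x s r y : ℕ → EuclideanSpace ℝ (Fin n)) (η : ℕ → ℝ)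
    (hrun : IsINLCondGRun F C θ N M x s r y)
    (hM₁ : ∀ k : ℕ, (k : ℕ∞) < N →
      ‖((M k).symm : EuclideanSpace ℝ (Fin n) →L[ℝ] EuclideanSpace ℝ (Fin n)) ∘L
        fderiv ℝ F (x k)‖ ≤ ω₁)
    (hM₂ : ∀ k : ℕ, (k : ℕ∞) < N →
      ‖((M k).symm : EuclideanSpace ℝ (Fin n) →L[ℝ] EuclideanSpace ℝ (Fin n)) ∘L
        fderiv ℝ F (x k) - ContinuousLinearMap.id ℝ (EuclideanSpace ℝ (Fin n))‖ ≤ ω₂)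
    (hr : ∀ k : ℕ, (k : ℕ∞) < N → ‖P k (r k)‖ ≤ η k * ‖P k (F (x k))‖)
    (hη : ∀ k : ℕ, (k : ℕ∞) < N →
      0 ≤ η k * condNumber
        ((P k : EuclideanSpace ℝ (Fin n) →L[ℝ] EuclideanSpace ℝ (Fin n)) ∘L fderiv ℝ F (x k)) ∧
      η k * condNumber
        ((P k : EuclideanSpace ℝ (Fin n) →L[ℝ] EuclideanSpace ℝ (Fin n)) ∘L fderiv ℝ F (x k))
          ≤ ϑ)
    (hx0 : x 0 ∈ (C ∩ Metric.eball xs σ) \ {xs})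
    (hθ : ∀ k : ℕ, θ k ∈ Set.Icc (0 : ℝ) (lam ^ 2 / 2)) :
    -- the iterates stay in `B(x_*, σ) ∩ C`
    (∀ k : ℕ, (k : ℕ∞) ≤ N → x k ∈ Metric.eball xs σ ∩ C) ∧
    -- convergence; if the method stops because `F (x k) = 0`, then `x k = x_*`
    (N = ⊤ → Tendsto x atTop (𝓝 xs)) ∧
    (∀ k : ℕ, (k : ℕ∞) ≤ N → F (x k) = 0 → x k = xs) ∧
    -- strict decrease of the error
    (∀ k : ℕ, (k : ℕ∞) < N → ‖x (k + 1) - xs‖ < ‖x k - xs‖) ∧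
    -- asymptotic rate
    (N = ⊤ → limsup (fun k : ℕ => ‖x (k + 1) - xs‖ / ‖x k - xs‖) atTop ≤
      ω₁ * ((1 + ϑ) * √(2 * limsup θ atTop) + ϑ) + ω₂) ∧
    -- quadratic-plus-linear error bound
    (∀ k : ℕ, (k : ℕ∞) < N → ‖x (k + 1) - xs‖ ≤
      ω₁ * (1 + ϑ) * (1 + lam) * γ / (2 * (1 - γ * ‖x 0 - xs‖) ^ 2 - 1) * ‖x k - xs‖ ^ 2 +
        (ω₁ * ((1 + ϑ) * lam + ϑ) + ω₂) * ‖x k - xs‖) := by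
  have hγ0 := smaleSet_isLUB_nonneg hγ
  have hω₁ : 0 < ω₁ := hω₂.trans_lt hω
  have hW : 0 < ω₁ * (1 + ϑ) := by positivity
  have hb0 : 0 < b := by
    rw [lt_div_iff₀ hW] at hlam1
    rw [hb]; linarith
  have ha' : a = ω₁ * (1 + ϑ) * (1 + lam) + 4 * b := by rw [ha, hb]; ring
  have hc0 : 0 < a - √(a ^ 2 - 8 * b ^ 2) := by
    have h1 : 0 < a := by rw [ha']; positivity
    rw [sub_pos, Real.sqrt_lt' h1]
    nlinarith
  have hlin : 0 ≤ ω₁ * ((1 + ϑ) * lam + ϑ) + ω₂ := by positivity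
  -- the estimates at a point of the ball
  have hball : ∀ z ∈ Metric.eball xs σ, (γ * ‖z - xs‖ < 1 / 2 ∧
      0 < 2 * (1 - γ * ‖z - xs‖) ^ 2 - 1 ∧
      ω₁ * (1 + ϑ) * (1 + lam) * (γ * ‖z - xs‖) <
        b * (2 * (1 - γ * ‖z - xs‖) ^ 2 - 1)) ∧
      (F z = 0 → z = xs) ∧
      ∃ B : EuclideanSpace ℝ (Fin n) ≃L[ℝ] EuclideanSpace ℝ (Fin n),
        (B : EuclideanSpace ℝ (Fin n) →L[ℝ] EuclideanSpace ℝ (Fin n)) = fderiv ℝ F z ∧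
        ‖B.symm (F z) - (z - xs)‖ ≤
          γ * ‖z - xs‖ ^ 2 / (2 * (1 - γ * ‖z - xs‖) ^ 2 - 1) := by
    intro z hz
    rw [Metric.mem_eball, hσ, lt_min_iff] at hz
    have hbd := discriminant_radius_bounds hW.le hlam0 hb0 ha' (by positivity)
      (mul_lt_of_edist_lt_div hc0 hz.2)
    obtain ⟨R, hRγ, hRΩ, hzR⟩ := exists_radius_of_lt_kappa hz.1
    obtain ⟨h1, h2⟩ := newton_bounds hγ (hF.mono hRΩ) hRγ hFxs hF'xs hzR
    exact ⟨hbd, h1 hbd.1, h2 hbd.2.1⟩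
  have hx0σ : x 0 ∈ Metric.eball xs σ := hx0.1.2
  obtain ⟨⟨hu0, hD0, hcontr⟩, -⟩ := hball (x 0) hx0σ
  set D := 2 * (1 - γ * ‖x 0 - xs‖) ^ 2 - 1 with hD
  have hsub : ∀ z, ‖z - xs‖ ≤ ‖x 0 - xs‖ → z ∈ Metric.eball xs σ := by
    intro z hz
    rw [Metric.mem_eball, edist_eq_enorm_sub] at hx0σ ⊢
    exact (enorm_le_iff_norm_le.mpr hz).trans_lt hx0σ
  -- one step, with a variable bound on the tolerance
  have hstep : ∀ k : ℕ, (k : ℕ∞) < N → ‖x k - xs‖ ≤ ‖x 0 - xs‖ → ∀ τ, 0 ≤ τ →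
      θ k ≤ τ ^ 2 / 2 → ‖x (k + 1) - xs‖ ≤
        ω₁ * (1 + ϑ) * (1 + τ) * γ / D * ‖x k - xs‖ ^ 2 +
          (ω₁ * ((1 + ϑ) * τ + ϑ) + ω₂) * ‖x k - xs‖ := by
    intro k hk hle τ hτ hθτ
    obtain ⟨⟨hu, hDk, -⟩, -, B, hB, he⟩ := hball (x k) (hsub _ hle)
    -- The denominator grows as the error shrinks, so its value at `x 0` serves for every step.
    have hDle : D ≤ 2 * (1 - γ * ‖x k - xs‖) ^ 2 - 1 := by
      have h1 : γ * ‖x k - xs‖ ≤ γ * ‖x 0 - xs‖ := by gcongr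
      have h2 : (1 - γ * ‖x 0 - xs‖) ^ 2 ≤ (1 - γ * ‖x k - xs‖) ^ 2 :=
        pow_le_pow_left₀ (by linarith) (by linarith) 2
      rw [hD]; linarith
    have he' : ‖B.symm (F (x k)) - (x k - xs)‖ ≤ γ * ‖x k - xs‖ ^ 2 / D :=
      he.trans (by gcongr)
    have h1 := hM₁ k hk
    have h2 := hM₂ k hk
    have h3 := (hη k hk).2
    rw [← hB] at h1 h2 h3
    have h4 := inlCondG_step_error hxsC hϑ0 (hrun.newton k hk) (hrun.target k hk) h1 h2
      (hr k hk) h3 he' hτ hθτ (hrun.next k hk)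
    have h5 : ω₁ * (1 + ϑ) * (1 + τ) * γ / D * ‖x k - xs‖ ^ 2 =
      ω₁ * (1 + ϑ) * (1 + τ) * (γ * ‖x k - xs‖ ^ 2 / D) := by ring
    rw [h5]
    exact h4
  -- The linear coefficient is exactly `1 - b`, and `hcontr` makes the quadratic contribution less
  -- than `b`.
  have hq : ω₁ * (1 + ϑ) * (1 + lam) * γ / D * ‖x 0 - xs‖ +
      (ω₁ * ((1 + ϑ) * lam + ϑ) + ω₂) < 1 := by
    have h1 : ω₁ * (1 + ϑ) * (1 + lam) * γ / D * ‖x 0 - xs‖ < b := by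
      rw [div_mul_eq_mul_div, div_lt_iff₀ hD0]
      linarith
    rw [hb] at h1
    linarith
  set q := ω₁ * (1 + ϑ) * (1 + lam) * γ / D * ‖x 0 - xs‖ +
      (ω₁ * ((1 + ϑ) * lam + ϑ) + ω₂) with hqdef
  have hK0 : 0 ≤ ω₁ * (1 + ϑ) * (1 + lam) * γ / D := by positivity
  have hq0 : 0 ≤ q := by positivity
  have hqstep : ∀ k : ℕ, (k : ℕ∞) < N → ‖x k - xs‖ ≤ ‖x 0 - xs‖ →
      ‖x (k + 1) - xs‖ ≤ q * ‖x k - xs‖ := by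
    intro k hk hle
    refine (hstep k hk hle lam hlam0 (hθ k).2).trans ?_
    have h1 : ω₁ * (1 + ϑ) * (1 + lam) * γ / D * ‖x k - xs‖ ^ 2 ≤
        ω₁ * (1 + ϑ) * (1 + lam) * γ / D * ‖x 0 - xs‖ * ‖x k - xs‖ := by
      rw [sq, ← mul_assoc]
      gcongr
    rw [hqdef, add_mul]
    linarith
  have hinv : ∀ k : ℕ, (k : ℕ∞) ≤ N → ‖x k - xs‖ ≤ ‖x 0 - xs‖ ∧ x k ∈ C := by
    intro k
    induction k with
    | zero => exact fun _ => ⟨le_rfl, hx0.1.1⟩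
    | succ k ih =>
      intro hk
      have hk' : (k : ℕ∞) < N := lt_of_lt_of_le (by exact_mod_cast k.lt_succ_self) hk
      obtain ⟨h1, h2⟩ := ih hk'.le
      have h3 := hqstep k hk' h1
      refine ⟨?_, (hrun.next k hk').mem hCconv (mul_nonneg (hθ k).1 (sq_nonneg _)) h2⟩
      nlinarith [norm_nonneg (x k - xs)]
  have hpos : ∀ k : ℕ, (k : ℕ∞) < N → 0 < ‖x k - xs‖ := by
    intro k hk
    rw [norm_pos_iff, sub_ne_zero]
    rintro h
    exact hrun.not_stopped k hk (h ▸ hFxs)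
  have htend : N = ⊤ → Tendsto (fun k => ‖x k - xs‖) atTop (𝓝 0) := by
    rintro rfl
    exact tendsto_zero_of_le_mul (fun _ => norm_nonneg _) hq0 hq fun k =>
      hqstep k (ENat.natCast_lt_top k) (hinv k le_top).1
  refine ⟨fun k hk => ⟨hsub _ (hinv k hk).1, (hinv k hk).2⟩,
    fun hN => tendsto_iff_norm_sub_tendsto_zero.mpr (htend hN),
    fun k hk => (hball (x k) (hsub _ (hinv k hk).1)).2.1, fun k hk => ?_, fun hN => ?_,
    fun k hk => hstep k hk (hinv k hk.le).1 lam hlam0 (hθ k).2⟩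
  · have h1 := hqstep k hk (hinv k hk.le).1
    nlinarith [hpos k hk]
  · have hrate : ∀ k, ‖x (k + 1) - xs‖ / ‖x k - xs‖ ≤
        ω₁ * (1 + ϑ) * (1 + lam) * γ / D * ‖x k - xs‖ +
          (ω₁ * (1 + ϑ) * √(2 * θ k) + (ω₁ * ϑ + ω₂)) := by
      intro k
      have hk : (k : ℕ∞) < N := hN ▸ ENat.natCast_lt_top k
      have hθ2 : 0 ≤ 2 * θ k := by linarith [(hθ k).1]
      -- `τ = √(2 θ k)` is the least admissible choice; in the quadratic term, negligible in the
      -- limit, it is replaced by `lam`.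
      have h1 := hstep k hk (hinv k hk.le).1 (√(2 * θ k)) (Real.sqrt_nonneg _)
        (by rw [Real.sq_sqrt hθ2]; linarith)
      have hτ : √(2 * θ k) ≤ lam := by
        rw [Real.sqrt_le_left hlam0]
        linarith [(hθ k).2]
      have h2 : ω₁ * (1 + ϑ) * (1 + √(2 * θ k)) * γ / D * ‖x k - xs‖ ^ 2 ≤
          ω₁ * (1 + ϑ) * (1 + lam) * γ / D * ‖x k - xs‖ ^ 2 := by gcongr
      rw [div_le_iff₀ (hpos k hk)]
      linarith
    have h := limsup_le_of_le_add_sqrt hW.le (htend hN) (fun k => by positivity)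
      (fun k => (hθ k).2) hrate
    linarith
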